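/- Conventions. An $n$-party protocol $\pi=(\mathsf P_1,\dots,\mathsf P_n)$ in the secure-channels point-to-point model is an $n$-tuple of interactive probabilistic Turing machines, each two of which are connected by a private authenticated channel. It is executed in synchronous rounds, each consisting of a send phase followed by a receive phase; every party holds a private input whose length is the security parameter $\kappa$. For $T,q\colon\mathbb N\to\mathbb N$, the protocol is $T$-time (resp. $q$-round) if for all inputs $x_i$, all random coins and all sequences of received messages, an honest $\mathsf P_i$ makes at most $T(|x_i|)$ steps in total (resp. stops being active in round $q(|x_i|)$ at the latest). A (non-uniform, malicious) adversary corrupting a set $\mathcal I$ of parties is a system of interactive probabilistic Turing machines: it has finitely many programs, independent of $\kappa$, and on security parameter $\kappa$ it runs finitely many processes, each an instance of one of these programs, where the processes, their inputs, their random tapes (which may be shared) and their interconnection with each other and with the channels between the corrupted and the honest parties are an advice depending on $\kappa$. It may work for some rounds before the protocol starts. It is a $\tau$-time adversary if its processes together make at most $\tau(\kappa)$ steps, where each process is charged its worst-case number of steps over all coins and all received messages (passing a message along a fixed connection is not charged). For $\gamma\colon\mathbb N\to\mathbb R$, the protocol $\pi$ is $(\gamma,t)$-consistent against $\tau$-time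 adversaries if for every $\tau$-time adversary corrupting at most $t$ parties, every $\kappa$ and every vector of inputs of length $\kappa$, with probability at least $\gamma(\kappa)$ over the coins of the adversary and of the honest parties, all honest parties output the same value. Statement. Let $n\ge 3$, let $t\ge \frac n3$, and let $s=n-2t$ if $t<\frac n2$ and $s=1$ otherwise. Let $T,q\colon\mathbb N\to\mathbb N$ with $q(\kappa)\ge 2$ for all $\kappa$, and let $\delta\colon\mathbb N\to\mathbb R$. Let $\pi$ be an $n$-party, $T$-time, $q$-round protocol in the secure-channels point-to-point model that is $(1-\delta,t)$-consistent against $2nqT$-time adversaries. Then there is a $2nqT$-time adversary $\mathsf D$ such that, given control over any $s$-size subset $\mathcal I$ of the parties, the following holds for every security parameter $\kappa$. First, before the execution of $\pi$ and independently of all the parties' inputs and of the honest parties' coins, $\mathsf D$ outputs a value $y^*=y^*(\mathcal I)$ (a function of $\mathcal I$, $\kappa$ and the coins of $\mathsf D$). Next, for every vector of inputs of length $\kappa$, $\mathsf D$ interacts with the honest parties of $\pi$ on these inputs, and, except for probability at most $\left(\frac32 q(\kappa)+1\right)\delta(\kappa)$ over the coins of $\mathsf D$ and of the honest parties, the output of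 every honest party is $y^*$. -/

import Mathlib

open MeasureTheory

/-! ### Interactive probabilistic machines -/

/-- The stacks through which a machine communicates: its private input, its output, and, for every
channel `c : ι`, the message received last on `c` and the message to be sent next on `c`. -/
inductive Port (ι : Type) : Type
  | input : Port ι
  | output : Port ι
  | recv (c : ι) : Port ι
  | send (c : ι) : Port ι

/-- An interactive probabilistic Turing machine with channels `ι`: a multi-stack machine with
finitely many labels, internal states and work stacks over finite alphabets, whose communication
stacks hold bits.  The instruction executed in a step depends on a fresh random bit.  The machine
works in activations: it starts at the label `main` and computes until the instruction `halt`, which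
ends the activation.  If the internal state then satisfies `final`, the machine has terminated;
otherwise it waits for the messages of the next round. -/
structure ITM (ι : Type) : Type 1 where
  K : Type
  [finK : Finite K]
  Γ : K → Type
  [finΓ : ∀ k, Finite (Γ k)]
  Λ : Type
  [finΛ : Finite Λ]
  σ : Type
  [finσ : Finite σ]
  main : Λ
  init : σ
  final : σ → Bool
  code : Bool → Λ → Turing.TM2.Stmt (Sum.elim (fun _ : Port ι => Bool) Γ) Λ σ

namespace ITM

variable {ι : Type} (M : ITM ι)

/-- The alphabets of all stacks. -/
abbrev Alphabet : Port ι ⊕ M.K → Type := Sum.elim (fun _ : Port ι => Bool) M.Γ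

/-- The state of a machine: its configuration, and the number of steps made since it was started. -/
structure State where
  cfg : Turing.TM2.Cfg M.Alphabet M.Λ M.σ
  clock : ℕ

variable {M}

/-- The content of a communication stack. -/
def State.read (s : M.State) (p : Port ι) : List Bool := s.cfg.stk (Sum.inl p)

/-- The machine has terminated (no further activation takes place). -/
def State.done (s : M.State) : Bool := M.final s.cfg.var

variable (M)

/-- The state before the first activation, on private input `x`. -/
def initial (x : List Bool) : M.State where
  cfg :=
    { l := none
      var := M.init
      stk := fun k => match k with
        | Sum.inl Port.input => x
        | Sum.inl _ => []
        | Sum.inr _ => [] }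
  clock := 0

/-- Beginning of an activation: the messages `msg` are delivered (they replace the previous ones),
the outgoing messages are cleared, and control goes to `main`. -/
def deliver (msg : ι → List Bool) (s : M.State) : M.State where
  cfg :=
    { l := some M.main
      var := s.cfg.var
      stk := fun k => match k with
        | Sum.inl (Port.recv c) => msg c
        | Sum.inl (Port.send _) => []
        | Sum.inl Port.input => s.cfg.stk (Sum.inl Port.input)
        | Sum.inl Port.output => s.cfg.stk (Sum.inl Port.output)
        | Sum.inr k => s.cfg.stk (Sum.inr k) }
  clock := s.clock

open Classical in
/-- One step with random tape `ω`; the `i`-th step uses the `i`-th bit of `ω`.  Nothing happens if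
the activation has ended. -/
noncomputable def step (ω : ℕ → Bool) (s : M.State) : M.State :=
  match Turing.TM2.step (M.code (ω s.clock)) s.cfg with
  | none => s
  | some c => ⟨c, s.clock + 1⟩

open Classical in
/-- The activation of a machine with incoming messages `msg`.  A terminated machine does nothing.
The value `none` stands for a computation that never ends. -/
noncomputable def activate (ω : ℕ → Bool) (msg : ι → List Bool) :
    Option M.State → Option M.State
  | none => none
  | some s =>
    if s.done then some s
    else if h : ∃ k : ℕ, ((M.step ω)^[k] (M.deliver msg s)).cfg.l = none then
      some ((M.step ω)^[Nat.find h] (M.deliver msg s))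
    else none

variable {M}

/-- The message that a machine sends on channel `c` at the end of an activation.  A terminated
machine sends nothing. -/
def sent (s : Option M.State) (c : ι) : List Bool :=
  match s with
  | none => []
  | some s => if s.done then [] else s.read (Port.send c)

/-- The output of a machine, once it has terminated. -/
def output (s : Option M.State) : Option (List Bool) :=
  match s with
  | none => none
  | some s => if s.done then some (s.read Port.output) else none

variable (M)

/-- The state after the receive phase of round `k` has been processed, when the machine runs with
private input `x` and random tape `ω`, and receives the messages `ρ (k - 1)` in round `k`.  There
are no messages before round `1`. -/
noncomputable def trace (x : List Bool) (ω : ℕ → Bool) (ρ : ℕ → ι → List Bool) :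
    ℕ → Option M.State
  | 0 => M.activate ω (fun _ => []) (some (M.initial x))
  | k + 1 => M.activate ω (ρ k) (trace x ω ρ k)

/-- On private input `x` the machine makes at most `b` steps altogether, whatever its random coins
and the messages that it receives are. -/
def StepsAtMost (x : List Bool) (b : ℕ) : Prop :=
  ∀ (ω : ℕ → Bool) (ρ : ℕ → ι → List Bool) (k : ℕ), ∃ s, M.trace x ω ρ k = some s ∧ s.clock ≤ b

/-- On private input `x` the machine stops being active in round `r` at the latest, whatever its
random coins and the messages that it receives are. -/
def RoundsAtMost (x : List Bool) (r : ℕ) : Prop :=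
  ∀ (ω : ℕ → Bool) (ρ : ℕ → ι → List Bool), ∃ s, M.trace x ω ρ r = some s ∧ s.done = true

end ITM

/-! ### Synchronous networks of machines -/

/-- A synchronous network with nodes `N`.  The node `v` runs `prog v` on private input `input v` and
is activated in every round from round `start v` on.  What arrives at `v` on channel `c` is what
another node sends on one of its channels, as given by `src v c`; no message ever arrives on `c` if
`src v c = none`. -/
structure Network (N : Type) : Type 1 where
  chan : N → Type
  prog : ∀ v, ITM (chan v)
  input : N → List Bool
  start : N → ℕ
  src : ∀ v, chan v → Option (Σ u, chan u)

namespace Network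

variable {N : Type} (A : Network N)

/-- The states of all nodes before the activations of round `k`, when `ω v` is the random tape of
node `v`.  In round `k` a node processes what was sent in round `k - 1`; a node that starts in
round `k` has not yet received anything. -/
noncomputable def run (ω : N → ℕ → Bool) : ℕ → ∀ v, Option (A.prog v).State
  | 0 => fun v => some ((A.prog v).initial (A.input v))
  | k + 1 => fun v =>
    if k < A.start v then run ω k v
    else if k = A.start v then (A.prog v).activate (ω v) (fun _ => []) (run ω k v)
    else (A.prog v).activate (ω v)
      (fun c => match A.src v c with
        | none => []
        | some u => ITM.sent (run ω k u.1) u.2)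
      (run ω k v)

/-- The node `v` eventually terminates with output `y`. -/
def Outputs (ω : N → ℕ → Bool) (v : N) (y : List Bool) : Prop :=
  ∃ k, ITM.output (A.run ω k v) = some y

end Network

/-- The distribution of independent random tapes, indexed by `J`, of independent fair bits. -/
noncomputable def fairCoins (J : Type) : Measure (J → ℕ → Bool) :=
  Measure.infinitePi fun _ : J => Measure.infinitePi fun _ : ℕ =>
    (PMF.uniformOfFintype Bool).toMeasure

/-! ### Protocols -/

/-- An `n`-party protocol in the point-to-point model: each party is an interactive machine with one
channel to every other party.  The security parameter is the length of its private input. -/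
abbrev Protocol (n : ℕ) : Type 1 := ∀ i : Fin n, ITM {j : Fin n // j ≠ i}

namespace Protocol

variable {n : ℕ} (π : Protocol n)

/-- `π` is a `T`-time protocol. -/
def IsTime (T : ℕ → ℕ) : Prop := ∀ (i : Fin n) (x : List Bool), (π i).StepsAtMost x (T x.length)

/-- `π` is a `q`-round protocol. -/
def IsRound (q : ℕ → ℕ) : Prop := ∀ (i : Fin n) (x : List Bool), (π i).RoundsAtMost x (q x.length)

end Protocol

/-! ### Adversaries -/

/-- An adversary that corrupts the parties in `I`.  Its program is a finite collection of
interactive machines, which does not depend on the security parameter `κ`.  On `κ` it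
runs finitely many processes, each of which is an instance of one of these machines; a single
interactive machine is the special case of one process.  As usual for non-uniform adversaries, the
set of processes, their inputs and their interconnection are an advice that depends on `κ`
(since it may be any advice, it may also contain the private inputs of the corrupted parties).

* `tape κ p` is the random tape that `p` uses: coins that were tossed once may be used again.
* The first `lead κ` rounds take place before the protocol starts.  The process `p` starts in
  round `start κ p`.
* `src κ p c` says where the messages that arrive at `p` on channel `c` come from: from nowhere, from
  a channel of a process, or from an honest party `a` as its messages to a corrupted party `i`.
* `reply κ i a` says where the messages of the corrupted party `i` to the honest party `a` come from:
  from nowhere, or from a channel of a process.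
* `speaker κ` is the process, if any, whose output is announced before the protocol starts. -/
structure Adversary (n : ℕ) (I : Finset (Fin n)) : Type 1 where
  Prog : Type
  [finProg : Finite Prog]
  chan : Prog → Type
  [finChan : ∀ a, Finite (chan a)]
  prog : ∀ a, ITM (chan a)
  Proc : ℕ → Type
  [fintypeProc : ∀ κ, Fintype (Proc κ)]
  kind : ∀ κ, Proc κ → Prog
  input : ∀ κ, Proc κ → List Bool
  Tape : ℕ → Type
  tape : ∀ κ, Proc κ → Tape κ
  lead : ℕ → ℕ
  start : ∀ κ, Proc κ → ℕ
  src : ∀ κ (p : Proc κ), chan (kind κ p) →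
    Option ((Σ p' : Proc κ, chan (kind κ p')) ⊕ ({a : Fin n // a ∉ I} × {i : Fin n // i ∈ I}))
  reply : ∀ κ, {i : Fin n // i ∈ I} → {a : Fin n // a ∉ I} →
    Option (Σ p' : Proc κ, chan (kind κ p'))
  speaker : ∀ κ, Option (Proc κ)

attribute [instance] Adversary.fintypeProc

namespace Adversary

variable {n : ℕ} {I : Finset (Fin n)} (D : Adversary n I)

/-- `D` is a `τ`-time adversary: on security parameter `κ` all its processes together make at most
`τ κ` steps, whatever the coins and the received messages are. -/
def IsTime (τ : ℕ → ℕ) : Prop :=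
  ∀ κ, ∃ b : D.Proc κ → ℕ,
    (∀ p, (D.prog (D.kind κ p)).StepsAtMost (D.input κ p) (b p)) ∧ ∑ p, b p ≤ τ κ

/-- The processes of the adversary alone, without the honest parties. -/
def alone (κ : ℕ) : Network (D.Proc κ) where
  chan p := D.chan (D.kind κ p)
  prog p := D.prog (D.kind κ p)
  input := D.input κ
  start := D.start κ
  src p c :=
    match D.src κ p c with
    | some (Sum.inl u) => some u
    | _ => none

/-- The value that the adversary announces before the protocol starts, as a function of its random
coins. -/
noncomputable def announced (κ : ℕ) (ω : D.Tape κ → ℕ → Bool) : Option (List Bool) :=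
  (D.speaker κ).bind fun p =>
    ITM.output ((D.alone κ).run (fun p' => ω (D.tape κ p')) (D.lead κ) p)

end Adversary

/-! ### Executions under attack -/

namespace Protocol

variable {n : ℕ} (π : Protocol n) {I : Finset (Fin n)} (D : Adversary n I) (κ : ℕ)
  (x : Fin n → List Bool)

/-- The channels of the honest parties and of the processes of the adversary. -/
def JointChan : {a : Fin n // a ∉ I} ⊕ D.Proc κ → Type
  | Sum.inl a => {j : Fin n // j ≠ a.1}
  | Sum.inr p => D.chan (D.kind κ p)

/-- A process of the adversary together with one of its channels, in the joint execution. -/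
def jointProc (u : Σ p : D.Proc κ, D.chan (D.kind κ p)) : Σ v, JointChan D κ v :=
  ⟨Sum.inr u.1, u.2⟩

/-- The channel of the honest party `a` to the party `j`, in the joint execution. -/
def jointHonest (a : {a : Fin n // a ∉ I}) (j : Fin n) (h : j ≠ a.1) : Σ v, JointChan D κ v :=
  ⟨Sum.inl a, ⟨j, h⟩⟩

/-- The programs in the joint execution. -/
def jointProg : ∀ v, ITM (JointChan D κ v)
  | Sum.inl a => π a.1
  | Sum.inr p => D.prog (D.kind κ p)

/-- The connections in the joint execution.  Two honest parties are connected by a secure channel;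
all that the adversary sees or controls is what the corrupted parties receive or send. -/
def jointSrc : ∀ v, JointChan D κ v → Option (Σ u, JointChan D κ u)
  | Sum.inl a, j =>
    if h : j.1 ∈ I then (D.reply κ ⟨j.1, h⟩ a).map (jointProc D κ)
    else some (jointHonest D κ ⟨j.1, h⟩ a.1 (Ne.symm j.2))
  | Sum.inr p, c =>
    (D.src κ p c).map fun
      | Sum.inl u => jointProc D κ u
      | Sum.inr (a, i) => jointHonest D κ a i.1 (fun h => a.2 (h ▸ i.2))

/-- The execution of `π` on security parameter `κ` and inputs `x` under the adversary `D`. -/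
def joint : Network ({a : Fin n // a ∉ I} ⊕ D.Proc κ) where
  chan := JointChan D κ
  prog := jointProg π D κ
  input := Sum.elim (fun a => x a.1) (D.input κ)
  start := Sum.elim (fun _ => D.lead κ) (D.start κ)
  src := jointSrc D κ

/-- The random coins of the execution: one tape for each honest party, and those of the
adversary. -/
abbrev Coins : Type := {a : Fin n // a ∉ I} ⊕ D.Tape κ → ℕ → Bool

/-- In the execution of `π` under `D` all honest parties output `y`. -/
def AllOutput (ω : Coins D κ) (y : List Bool) : Prop :=
  ∀ a : {a : Fin n // a ∉ I},
    (joint π D κ x).Outputs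
      (fun v => ω (Sum.map id (D.tape κ) v)) (Sum.inl a) y

/-- The probability of an event in the execution of `π` under `D`, over the coins of the honest
parties and of the adversary. -/
noncomputable def prob (E : Coins D κ → Prop) : ℝ :=
  (fairCoins ({a : Fin n // a ∉ I} ⊕ D.Tape κ)).real {ω | E ω}

/-- `π` is `(γ, t)`-consistent against `τ`-time adversaries. -/
def IsConsistent (γ : ℕ → ℝ) (t : ℕ) (τ : ℕ → ℕ) : Prop :=
  ∀ (I : Finset (Fin n)), I.card ≤ t → ∀ D : Adversary n I, D.IsTime τ →
    ∀ (κ : ℕ) (x : Fin n → List Bool), (∀ i, (x i).length = κ) →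
      γ κ ≤ prob D κ fun ω => ∃ y, AllOutput π D κ x ω y

end Protocol

/-! Split the parties into three nonempty groups of at most `t` parties, one of them `I`, and lay `q
κ` copies of each group cyclically along a path of `3 * q κ` positions, where a copy talks only to
positions at distance at most one. Two adjacent positions then look like the honest parties of a
real execution in which the third group is corrupted and simulates the rest of the path
(`jointRun_attack`). Hence consistency makes adjacent positions agree except with probability `δ κ`
(`le_measure_pathAgree`), and by a union bound over `q κ + 2` adjacent pairs the positions `0` to `q
κ + 2` share one output, except with probability `(q κ + 2) * δ κ`.

Information travels one position per round, so the output at position `q κ + 2` does not depend on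
inputs and coins at the positions `0` and `1` (`pathRun_congr`). The adversary seats the honest
parties at these two positions. It computes the output at `q κ + 2` beforehand, in a rehearsal of
the whole path with dummy inputs, and reuses the same coins in the attack; the honest parties are
thereby led to the announced value. Finally `q κ + 2 ≤ 3 / 2 * q κ + 1` because `q κ ≥ 2`. -/

open Filter Topology

/-! ### Machines: stability of outputs, continuity in the coins -/

namespace ITM

variable {ι : Type} {M : ITM ι}

theorem activate_of_done {s : M.State} (hs : s.done = true) (ω : ℕ → Bool) (msg : ι → List Bool) :
    M.activate ω msg (some s) = some s := by
  simp [activate, hs]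

theorem activate_of_output {s : Option M.State} {y : List Bool} (h : output s = some y)
    (ω : ℕ → Bool) (msg : ι → List Bool) : M.activate ω msg s = s := by
  cases s with
  | none => simp [output] at h
  | some s =>
    by_cases hs : s.done = true
    · exact activate_of_done hs ω msg
    · simp [output, hs] at h

theorem exists_output_of_done {s : M.State} (hs : s.done = true) : ∃ y, output (some s) = some y :=
  ⟨s.read Port.output, by simp [output, hs]⟩

/-- Each step reads a single bit of the tape, and agreement in one coordinate is an open condition
in the product topology. -/
theorem eventually_iterate_step_eq (τ : ℕ → Bool) (s : M.State) (k : ℕ) :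
    ∀ᶠ τ' in 𝓝 τ, (M.step τ')^[k] s = (M.step τ)^[k] s := by
  induction k with
  | zero => simp
  | succ k ih =>
    have hbit : ∀ᶠ τ' in 𝓝 τ, τ' ((M.step τ)^[k] s).clock = τ ((M.step τ)^[k] s).clock := by
      have hc : Continuous fun τ' : ℕ → Bool => τ' ((M.step τ)^[k] s).clock := continuous_apply _
      exact ((isOpen_discrete {τ ((M.step τ)^[k] s).clock}).preimage hc).mem_nhds rfl
    filter_upwards [ih, hbit] with τ' h₁ h₂
    rw [Function.iterate_succ_apply', Function.iterate_succ_apply', h₁]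
    simp only [step, h₂]

/-- An activation that ends reads only finitely many bits of the random tape. -/
theorem eventually_activate_eq {τ : ℕ → Bool} {msg : ι → List Bool} {s : Option M.State}
    (h : M.activate τ msg s ≠ none) :
    ∀ᶠ τ' in 𝓝 τ, M.activate τ' msg s = M.activate τ msg s := by
  classical
  cases s with
  | none => exact absurd rfl h
  | some s =>
    by_cases hs : s.done = true
    · simp [activate_of_done hs]
    by_cases hk : ∃ k : ℕ, ((M.step τ)^[k] (M.deliver msg s)).cfg.l = none
    · have hall : ∀ᶠ τ' in 𝓝 τ, ∀ i ∈ Finset.range (Nat.find hk + 1),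
          (M.step τ')^[i] (M.deliver msg s) = (M.step τ)^[i] (M.deliver msg s) :=
        (eventually_all_finset _).2 fun i _ => eventually_iterate_step_eq τ _ i
      filter_upwards [hall] with τ' hτ'
      have heq : ∀ i ≤ Nat.find hk,
          (M.step τ')^[i] (M.deliver msg s) = (M.step τ)^[i] (M.deliver msg s) :=
        fun i hi => hτ' i (Finset.mem_range.2 (Nat.lt_succ_of_le hi))
      have hk' : ∃ k : ℕ, ((M.step τ')^[k] (M.deliver msg s)).cfg.l = none :=
        ⟨Nat.find hk, by rw [heq _ le_rfl]; exact Nat.find_spec hk⟩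
      have hfind : Nat.find hk' = Nat.find hk := by
        rw [Nat.find_eq_iff]
        refine ⟨by rw [heq _ le_rfl]; exact Nat.find_spec hk, fun m hm => ?_⟩
        rw [heq m hm.le]
        exact Nat.find_min hk hm
      have h₁ : M.activate τ msg (some s) =
          some ((M.step τ)^[Nat.find hk] (M.deliver msg s)) := by
        simp only [activate, hs]
        rw [if_neg (by simp), dif_pos hk]
      have h₂ : M.activate τ' msg (some s) =
          some ((M.step τ')^[Nat.find hk'] (M.deliver msg s)) := by
        simp only [activate, hs]
        rw [if_neg (by simp), dif_pos hk']
      rw [h₁, h₂, hfind, heq _ le_rfl]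
    · refine absurd ?_ h
      simp only [activate, hs]
      rw [if_neg (by simp), dif_neg hk]

end ITM

/-! ### Runs of networks -/

namespace Network

variable {N : Type} (A : Network N)

/-- The messages that the node `v` processes in round `k`. -/
noncomputable def incoming (ω : N → ℕ → Bool) (k : ℕ) (v : N) (c : A.chan v) : List Bool :=
  if k ≤ A.start v then []
  else match A.src v c with
    | none => []
    | some u => ITM.sent (A.run ω k u.1) u.2

theorem run_succ (ω : N → ℕ → Bool) (k : ℕ) (v : N) :
    A.run ω (k + 1) v = if k < A.start v then A.run ω k v
      else (A.prog v).activate (ω v) (A.incoming ω k v) (A.run ω k v) := by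
  simp only [run]
  rcases lt_trichotomy k (A.start v) with h | h | h
  · simp [h]
  · rw [if_neg (by omega), if_pos h, if_neg (by omega)]
    congr 1
    funext c
    simp [incoming, h]
  · rw [if_neg (by omega), if_neg (by omega), if_neg (by omega)]
    congr 1
    funext c
    refine Eq.trans ?_ (if_neg (not_le.2 h)).symm
    cases A.src v c <;> rfl

theorem incoming_of_le {k : ℕ} {v : N} (hk : k ≤ A.start v) (ω : N → ℕ → Bool) (c : A.chan v) :
    A.incoming ω k v c = [] :=
  if_pos hk

theorem incoming_of_none {v : N} {c : A.chan v} (hc : A.src v c = none) (ω : N → ℕ → Bool)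
    (k : ℕ) : A.incoming ω k v c = [] := by
  simp [incoming, hc]

theorem incoming_of_some {k : ℕ} {v : N} {c : A.chan v} (hk : A.start v < k)
    {u : Σ u, A.chan u} (hc : A.src v c = some u) (ω : N → ℕ → Bool) :
    A.incoming ω k v c = ITM.sent (A.run ω k u.1) u.2 := by
  simp [incoming, hc, hk]

theorem run_succ_of_le {k : ℕ} {v : N} (hk : A.start v ≤ k) (ω : N → ℕ → Bool) :
    A.run ω (k + 1) v = (A.prog v).activate (ω v) (A.incoming ω k v) (A.run ω k v) :=
  (A.run_succ ω k v).trans (if_neg (not_lt.2 hk))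

theorem run_of_le_start (ω : N → ℕ → Bool) {k : ℕ} {v : N} (h : k ≤ A.start v) :
    A.run ω k v = some ((A.prog v).initial (A.input v)) := by
  induction k with
  | zero => rfl
  | succ k ih => rw [run_succ, if_pos (by omega), ih (by omega)]

/-- The bounds on time and rounds hold for all received messages, so they apply to the messages that
a node happens to receive in a network. -/
theorem exists_run_eq_trace (ω : N → ℕ → Bool) {v : N} (hv : A.start v = 0) :
    ∃ ρ, ∀ k, A.run ω (k + 1) v = (A.prog v).trace (A.input v) (ω v) ρ k := by
  -- The shift by one reflects that round `0` processes no messages.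
  refine ⟨fun k => A.incoming ω (k + 1) v, fun k => ?_⟩
  induction k with
  | zero =>
    rw [run_succ, if_neg (by omega), ITM.trace]
    congr 1
  | succ k ih => rw [run_succ, if_neg (by omega), ih, ITM.trace]

theorem output_run_mono {ω : N → ℕ → Bool} {k l : ℕ} {v : N} {y : List Bool}
    (h : ITM.output (A.run ω k v) = some y) (hkl : k ≤ l) :
    ITM.output (A.run ω l v) = some y := by
  induction l, hkl using Nat.le_induction with
  | base => exact h
  | succ l _ ih =>
    rw [run_succ]
    split_ifs
    · exact ih
    · rw [ITM.activate_of_output ih]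
      exact ih

theorem outputs_iff {ω : N → ℕ → Bool} {k : ℕ} {v : N} {y z : List Bool}
    (h : ITM.output (A.run ω k v) = some z) : A.Outputs ω v y ↔ z = y := by
  refine ⟨fun ⟨l, hl⟩ => ?_, fun hz => ⟨k, hz ▸ h⟩⟩
  have h₁ := A.output_run_mono h (le_max_left k l)
  have h₂ := A.output_run_mono hl (le_max_right k l)
  exact Option.some_injective _ (h₁.symm.trans h₂)

/-- In a finite network of machines that halt, the state of a node after finitely many rounds
depends on finitely many coins only. -/
theorem eventually_run_eq [Finite N] (hA : ∀ ω k v, A.run ω k v ≠ none) (ω : N → ℕ → Bool)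
    (k : ℕ) : ∀ᶠ ω' in 𝓝 ω, ∀ v, A.run ω' k v = A.run ω k v := by
  induction k with
  | zero => exact Eventually.of_forall fun _ _ => rfl
  | succ k ih =>
    refine eventually_all.2 fun v => ?_
    by_cases hk : k < A.start v
    · filter_upwards [ih] with ω' h
      rw [run_succ, run_succ, if_pos hk, if_pos hk, h]
    · have hact := hA ω (k + 1) v
      rw [run_succ, if_neg hk] at hact
      have h' := (continuous_apply v).continuousAt.eventually (ITM.eventually_activate_eq hact)
      filter_upwards [ih, h'] with ω' h₁ h₂
      have hin : A.incoming ω' k v = A.incoming ω k v := by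
        funext c
        simp only [incoming, h₁]
      rw [run_succ, run_succ, if_neg hk, if_neg hk, hin, h₁]
      exact h₂

/-- The run up to round `k` is locally constant in the coins, so every event about it is open. -/
theorem measurableSet_run [Finite N] (hA : ∀ ω k v, A.run ω k v ≠ none) (k : ℕ)
    (P : (∀ v, Option (A.prog v).State) → Prop) : MeasurableSet {ω | P (A.run ω k)} := by
  refine IsOpen.measurableSet (isOpen_iff_mem_nhds.2 fun ω hω => ?_)
  filter_upwards [A.eventually_run_eq hA ω k] with ω' h
  have : A.run ω' k = A.run ω k := funext h
  simpa [this] using hω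

end Network

/-! ### Independence of selected tapes -/

instance (J : Type) : IsProbabilityMeasure (fairCoins J) := by
  unfold fairCoins
  infer_instance

/-- Choosing some of the tapes, without repetition, yields independent tapes. -/
theorem measurePreserving_fairCoins_comp {J J' : Type} {f : J → J'} (hf : Function.Injective f) :
    MeasurePreserving (fun ω : J' → ℕ → Bool => ω ∘ f) (fairCoins J') (fairCoins J) := by
  classical
  have hm : Measurable (fun ω : J' → ℕ → Bool => ω ∘ f) :=
    measurable_pi_lambda _ fun j => measurable_pi_apply (f j)
  refine ⟨hm, Measure.eq_infinitePi _ fun s t ht => ?_⟩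
  -- A box pulls back to a box over the image of `f`; injectivity ensures that no coordinate is
  -- constrained twice.
  have hpre : (fun ω : J' → ℕ → Bool => ω ∘ f) ⁻¹' Set.pi s t =
      Set.pi (s.image f : Finset J') (Function.extend f t fun _ => Set.univ) := by
    ext ω
    simp [Set.mem_pi, hf.extend_apply]
  rw [Measure.map_apply hm (MeasurableSet.pi s.countable_toSet fun i _ => ht i), hpre, fairCoins,
    Measure.infinitePi_pi]
  · rw [Finset.prod_image fun _ _ _ _ h => hf h]
    simp [hf.extend_apply]
  · intro i hi
    obtain ⟨j, _, rfl⟩ := Finset.mem_image.1 hi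
    rw [hf.extend_apply]
    exact ht j

/-! ### Copies of the parties, arranged along a path -/

/-- The position on the path of a copy of a party. -/
def pathPos {n m : ℕ} (g : Fin n → Fin 3) (v : Fin m × Fin n) : ℕ := 3 * v.1.val + (g v.2).val

/-- The copy of the party `i` at distance at most one from the position `p`. -/
def nearCopy {n : ℕ} (m : ℕ) (g : Fin n → Fin 3) (p : ℕ) (i : Fin n) : Option (Fin m) :=
  if h : (g i).val ≤ p + 1 ∧ (p + 1 - (g i).val) / 3 < m then some ⟨_, h.2⟩ else none

/-- Three consecutive integers contain each residue modulo `3` once, so at most one copy of a party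
is near `p`; it is missing only beyond the ends of the path. The condition is symmetric, so channels
match up in both directions. -/
theorem nearCopy_eq_some_iff {n m : ℕ} {g : Fin n → Fin 3} {p : ℕ} {i : Fin n} {b : Fin m} :
    nearCopy m g p i = some b ↔ pathPos g (b, i) ≤ p + 1 ∧ p ≤ pathPos g (b, i) + 1 := by
  have hg := (g i).isLt
  have hb := b.isLt
  unfold nearCopy pathPos
  constructor
  · intro h
    split_ifs at h with h'
    have := congrArg Fin.val (Option.some_injective _ h)
    dsimp only at this ⊢
    omega
  · intro h
    dsimp only at h
    rw [dif_pos (by omega)]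
    congr 1
    ext
    dsimp only
    omega

/-- The network of `m` copies of every party, where the copies of the parties `i` with `g i = r`
sit at the positions congruent to `r` modulo `3`, and every copy is connected to the copies
at distance at most one. -/
def Protocol.path {n : ℕ} (π : Protocol n) (m : ℕ) (g : Fin n → Fin 3)
    (inp : Fin m × Fin n → List Bool) : Network (Fin m × Fin n) where
  chan v := {j : Fin n // j ≠ v.2}
  prog v := π v.2
  input := inp
  start _ := 0
  src v c := (nearCopy m g (pathPos g v) c.1).map fun b => ⟨(b, c.1), ⟨v.2, Ne.symm c.2⟩⟩

namespace Protocol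

variable {n : ℕ} (π : Protocol n) {m : ℕ} (g : Fin n → Fin 3) (inp : Fin m × Fin n → List Bool)

/-- The state of a copy of a party before round `k`, in the network without adversary. -/
noncomputable def pathRun (ω : Fin m × Fin n → ℕ → Bool) (k : ℕ) (v : Fin m × Fin n) :
    Option (π v.2).State :=
  (π.path m g inp).run ω k v

/-- The messages that a copy of a party processes in round `k`. -/
noncomputable def pathIncoming (ω : Fin m × Fin n → ℕ → Bool) (k : ℕ) (v : Fin m × Fin n)
    (c : {j : Fin n // j ≠ v.2}) : List Bool :=
  if k = 0 then [] else match nearCopy m g (pathPos g v) c.1 with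
    | none => []
    | some b => ITM.sent (π.pathRun g inp ω k (b, c.1)) ⟨v.2, Ne.symm c.2⟩

theorem incoming_path (ω : Fin m × Fin n → ℕ → Bool) (k : ℕ) (v : Fin m × Fin n) :
    (π.path m g inp).incoming ω k v = π.pathIncoming g inp ω k v := by
  funext c
  rcases Nat.eq_zero_or_pos k with rfl | hk
  · exact (π.path m g inp).incoming_of_le le_rfl ω c
  · unfold pathIncoming
    rw [if_neg hk.ne']
    cases hb : nearCopy m g (pathPos g v) c.1 with
    | none => exact (π.path m g inp).incoming_of_none (congrArg (Option.map _) hb) ω k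
    | some b => exact (π.path m g inp).incoming_of_some hk (congrArg (Option.map _) hb) ω

theorem pathRun_succ (ω : Fin m × Fin n → ℕ → Bool) (k : ℕ) (v : Fin m × Fin n) :
    π.pathRun g inp ω (k + 1) v =
      (π v.2).activate (ω v) (π.pathIncoming g inp ω k v) (π.pathRun g inp ω k v) := by
  rw [← incoming_path]
  exact (π.path m g inp).run_succ_of_le (Nat.zero_le k) ω

theorem run_path_ne_none {T : ℕ → ℕ} (hT : π.IsTime T) (ω : Fin m × Fin n → ℕ → Bool) (k : ℕ)
    (v : Fin m × Fin n) : (π.path m g inp).run ω k v ≠ none := by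
  cases k with
  | zero => exact Option.some_ne_none _
  | succ k =>
    obtain ⟨ρ, hρ⟩ := (π.path m g inp).exists_run_eq_trace ω (v := v) rfl
    obtain ⟨s, hs, -⟩ := hT v.2 (inp v) (ω v) ρ k
    exact fun h => Option.some_ne_none s (((hρ k).trans hs).symm.trans h)

/-- The output of a copy of a party, in the network without adversary. -/
noncomputable def pathOutput (r : ℕ) (ω : Fin m × Fin n → ℕ → Bool) (v : Fin m × Fin n) :
    Option (List Bool) :=
  ITM.output (π.pathRun g inp ω (r + 1) v)

theorem exists_pathOutput {q : ℕ → ℕ} (hR : π.IsRound q) (ω : Fin m × Fin n → ℕ → Bool)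
    (v : Fin m × Fin n) : ∃ y, π.pathOutput g inp (q (inp v).length) ω v = some y := by
  obtain ⟨ρ, hρ⟩ := (π.path m g inp).exists_run_eq_trace ω (v := v) rfl
  obtain ⟨s, hs, hdone⟩ := hR v.2 (inp v) (ω v) ρ
  -- `trace` counts its first activation as index `0`, hence the `+ 1`.
  have : π.pathRun g inp ω (q (inp v).length + 1) v = some s := (hρ _).trans hs
  rw [pathOutput, this]
  exact ITM.exists_output_of_done hdone

/-- After `k` rounds the copies at distance at least `k` from the positions `0` and `1` have not
been influenced by the copies there. -/
theorem pathRun_congr {inp' : Fin m × Fin n → List Bool} {ω ω' : Fin m × Fin n → ℕ → Bool}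
    (hinp : ∀ v, 2 ≤ pathPos g v → inp v = inp' v) (hω : ∀ v, 2 ≤ pathPos g v → ω v = ω' v)
    (k : ℕ) : ∀ v, 2 ≤ pathPos g v → k + 1 ≤ pathPos g v →
      π.pathRun g inp ω k v = π.pathRun g inp' ω' k v := by
  induction k with
  | zero =>
    intro v hv _
    exact congrArg (fun x => some ((π v.2).initial x)) (hinp v hv)
  | succ k ih =>
    intro v hv hk
    have hin : π.pathIncoming g inp ω k v = π.pathIncoming g inp' ω' k v := by
      funext c
      unfold pathIncoming
      -- Nothing arrives in round `0`, which keeps the bound at `k + 1`. For `k ≥ 1` a neighbour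
      -- sits at a position at least `k + 1 ≥ 2`, within reach of the induction hypothesis.
      split_ifs with h0
      · rfl
      · cases hc : nearCopy m g (pathPos g v) c.1 with
        | none => rfl
        | some b =>
          have := nearCopy_eq_some_iff.1 hc
          simp only
          rw [ih (b, c.1) (by omega) (by omega)]
    rw [pathRun_succ, pathRun_succ, hω v hv, ih v hv (by omega), hin]

theorem measurableSet_pathOutput {T : ℕ → ℕ} (hT : π.IsTime T) (r : ℕ)
    (P : (Fin m × Fin n → Option (List Bool)) → Prop) :
    MeasurableSet {ω | P (π.pathOutput g inp r ω)} :=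
  (π.path m g inp).measurableSet_run (π.run_path_ne_none g inp hT) (r + 1)
    fun st => P fun v => ITM.output (st v)

end Protocol

/-! ### The attack -/

/-- The adversary that corrupts the parties in `I` and runs copies of all parties along a path of
`3 * q κ` positions, twice with the same coins: a rehearsal before the protocol starts (the
processes `(false, v)`), and an execution in which the honest parties take the places of their
copies at the positions `j` and `j + 1` (the processes `(true, v)`).  It announces the output that
a copy at position `q κ + 2` has in the rehearsal. -/
noncomputable def Protocol.attack {n : ℕ} (π : Protocol n) (q : ℕ → ℕ) (g : Fin n → Fin 3)
    (inp : ∀ κ, Fin (q κ) × Fin n → List Bool) (j : ℕ) (I : Finset (Fin n)) : Adversary n I where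
  Prog := Fin n
  chan a := {c : Fin n // c ≠ a}
  prog a := π a
  Proc κ := Bool × (Fin (q κ) × Fin n)
  kind _ p := p.2.2
  input κ p := inp κ p.2
  Tape κ := Fin (q κ) × Fin n
  tape _ p := p.2
  lead κ := q κ + 1
  start κ p := if p.1 then q κ + 1 else 0
  src κ p c := (nearCopy (q κ) g (pathPos g p.2) c.1).bind fun b =>
    if p.1 = true ∧ (pathPos g (b, c.1) = j ∨ pathPos g (b, c.1) = j + 1) then
      if h : c.1 ∉ I ∧ p.2.2 ∈ I then some (Sum.inr (⟨c.1, h.1⟩, ⟨p.2.2, h.2⟩)) else none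
    else some (Sum.inl ⟨(p.1, (b, c.1)), ⟨p.2.2, Ne.symm c.2⟩⟩)
  reply κ i a := (nearCopy (q κ) g j a.1).bind fun b =>
    (nearCopy (q κ) g (pathPos g (b, a.1)) i.1).map fun b' =>
      ⟨(true, (b', i.1)), ⟨a.1, fun h => a.2 (h ▸ i.2)⟩⟩
  speaker κ := open Classical in
    if h : ∃ v : Fin (q κ) × Fin n, pathPos g v = q κ + 2 then some (false, h.choose) else none

namespace Protocol

variable {n : ℕ} (π : Protocol n) (q : ℕ → ℕ) (g : Fin n → Fin 3)
  (inp : ∀ κ, Fin (q κ) × Fin n → List Bool) (j : ℕ) (I : Finset (Fin n))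

/-- Rehearsal and execution each run `n * q κ` copies, and each copy makes at most `T κ` steps. -/
theorem isTime_attack {T : ℕ → ℕ} (hT : π.IsTime T) (hinp : ∀ κ v, (inp κ v).length = κ) :
    (π.attack q g inp j I).IsTime fun κ => 2 * n * q κ * T κ := by
  intro κ
  refine ⟨fun _ => T κ, fun p => ?_, ?_⟩
  · have := hT p.2.2 (inp κ p.2)
    rw [hinp] at this
    exact this
  · rw [Finset.sum_const, Finset.card_univ, smul_eq_mul]
    have : Fintype.card ((π.attack q g inp j I).Proc κ) = 2 * n * q κ := by
      change Fintype.card (Bool × (Fin (q κ) × Fin n)) = _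
      simp
      ring
    rw [this]

/-- The state of a copy of a party in the rehearsal. -/
noncomputable def rehearsalRun (κ : ℕ) (ω : Fin (q κ) × Fin n → ℕ → Bool) (k : ℕ)
    (v : Fin (q κ) × Fin n) : Option (π v.2).State :=
  ((π.attack q g inp j I).alone κ).run (fun p => ω ((π.attack q g inp j I).tape κ p)) k (false, v)

/-- Rehearsal processes start in round `0` and listen only to each other, so they form the
undisturbed path. -/
theorem rehearsalRun_eq (κ : ℕ) (ω : Fin (q κ) × Fin n → ℕ → Bool) (k : ℕ) :
    ∀ v, π.rehearsalRun q g inp j I κ ω k v = π.pathRun g (inp κ) ω k v := by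
  induction k with
  | zero => exact fun _ => rfl
  | succ k ih =>
    intro v
    rw [pathRun_succ, ← ih]
    refine (((π.attack q g inp j I).alone κ).run_succ_of_le (Nat.zero_le k) _).trans ?_
    refine congrArg (fun msg => (π v.2).activate (ω v) msg (π.rehearsalRun q g inp j I κ ω k v))
      (funext fun c : {j : Fin n // j ≠ v.2} => ?_)
    have hsrc : ((π.attack q g inp j I).alone κ).src (false, v) c =
        (nearCopy (q κ) g (pathPos g v) c.1).map fun b =>
          ⟨(false, (b, c.1)), ⟨v.2, Ne.symm c.2⟩⟩ := by
      simp only [Adversary.alone, attack]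
      cases nearCopy (q κ) g (pathPos g v) c.1 <;> simp
    rcases Nat.eq_zero_or_pos k with rfl | hk
    · exact ((π.attack q g inp j I).alone κ).incoming_of_le (v := (false, v)) le_rfl _ c
    · unfold pathIncoming
      rw [if_neg hk.ne']
      cases hb : nearCopy (q κ) g (pathPos g v) c.1 with
      | none =>
        exact ((π.attack q g inp j I).alone κ).incoming_of_none
          (hsrc.trans (congrArg (Option.map _) hb)) _ k
      | some b =>
        refine (((π.attack q g inp j I).alone κ).incoming_of_some hk
          (hsrc.trans (congrArg (Option.map _) hb)) _).trans ?_
        exact congrArg (fun s => ITM.sent s ⟨v.2, Ne.symm c.2⟩) (ih (b, c.1))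

theorem exists_announced_attack {κ : ℕ} (h : ∃ v : Fin (q κ) × Fin n, pathPos g v = q κ + 2) :
    ∃ v : Fin (q κ) × Fin n, pathPos g v = q κ + 2 ∧
      ∀ ω : Fin (q κ) × Fin n → ℕ → Bool, (π.attack q g inp j I).announced κ ω =
        π.pathOutput g (inp κ) (q κ) ω v := by
  refine ⟨h.choose, h.choose_spec, fun ω => ?_⟩
  have hs : (π.attack q g inp j I).speaker κ = some (false, h.choose) := by
    simp only [attack]
    exact dif_pos h
  refine (congrArg (Option.bind · _) hs).trans ?_
  exact congrArg ITM.output (π.rehearsalRun_eq q g inp j I κ ω (q κ + 1) h.choose)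

end Protocol

/-! ### The attacked execution is a run of the path -/

namespace Protocol

variable {n : ℕ} (π : Protocol n) (q : ℕ → ℕ) (g : Fin n → Fin 3)
  (inp : ∀ κ, Fin (q κ) × Fin n → List Bool) (j : ℕ) (I : Finset (Fin n))
  (κ : ℕ) (x : Fin n → List Bool)

/-- The inputs in the network that the attack simulates: those of the honest parties at the
positions `j` and `j + 1`, and those of the processes elsewhere. -/
def seatedInput (v : Fin (q κ) × Fin n) : List Bool :=
  if pathPos g v = j ∨ pathPos g v = j + 1 then x v.2 else inp κ v

open Classical in
/-- The tapes in the network that the attack simulates. -/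
noncomputable def seatedTape (v : Fin (q κ) × Fin n) :
    {a : Fin n // a ∉ I} ⊕ (Fin (q κ) × Fin n) :=
  if h : (pathPos g v = j ∨ pathPos g v = j + 1) ∧ v.2 ∉ I then Sum.inl ⟨v.2, h.2⟩
  else Sum.inr v

/-- A party has at most one copy on two consecutive positions, so no honest tape is used twice and
the seated tapes are independent. -/
theorem injective_seatedTape : Function.Injective (seatedTape q g j I κ) := by
  intro v w h
  unfold seatedTape at h
  split_ifs at h with hv hw hw
  · have hp : v.2 = w.2 := congrArg Subtype.val (Sum.inl_injective h)
    have h₁ := hv.1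
    have h₂ := hw.1
    unfold pathPos at h₁ h₂
    rw [hp] at h₁
    exact Prod.ext (Fin.ext (by omega)) hp
  · exact Sum.inr_injective h

/-- The state of an honest party under the attack. -/
noncomputable def attackedRun (ω : Coins (π.attack q g inp j I) κ) (k : ℕ)
    (a : {a : Fin n // a ∉ I}) : Option (π a.1).State :=
  (joint π (π.attack q g inp j I) κ x).run
    (fun v => ω (Sum.map id ((π.attack q g inp j I).tape κ) v)) k (Sum.inl a)

/-- The state of a process that takes part in the execution of the attacked protocol. -/
noncomputable def simulatedRun (ω : Coins (π.attack q g inp j I) κ) (k : ℕ)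
    (v : Fin (q κ) × Fin n) : Option (π v.2).State :=
  (joint π (π.attack q g inp j I) κ x).run
    (fun v => ω (Sum.map id ((π.attack q g inp j I).tape κ) v)) k (Sum.inr (true, v))

variable {I} {j}

/-- The corrupted group has the residue of `j - 1` and `j + 2`. It faces the honest parties at `j`
through its copies at `j - 1` and those at `j + 1` through its copies at `j + 2`, so every honest
party sees exactly what its copy sees on the path. The execution processes at the seats themselves
are idle duplicates that nobody listens to. -/
theorem jointRun_attack (hI : ∀ i, i ∈ I ↔ (g i).val ≠ j % 3 ∧ (g i).val ≠ (j + 1) % 3)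
    (seat : {a : Fin n // a ∉ I} → Fin (q κ))
    (hseat : ∀ a, pathPos g (seat a, a.1) = j ∨ pathPos g (seat a, a.1) = j + 1)
    (ω : Coins (π.attack q g inp j I) κ) (k : ℕ) :
    (∀ a, π.attackedRun q g inp j I κ x ω (q κ + 1 + k) a =
      π.pathRun g (seatedInput q g inp j κ x) (ω ∘ seatedTape q g j I κ) k (seat a, a.1)) ∧
    ∀ v, pathPos g v ≠ j → pathPos g v ≠ j + 1 →
      π.simulatedRun q g inp j I κ x ω (q κ + 1 + k) v =
      π.pathRun g (seatedInput q g inp j κ x) (ω ∘ seatedTape q g j I κ) k v := by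
  have hseat_eq : ∀ (c : Fin n) (hc : c ∉ I) (b : Fin (q κ)),
      (pathPos g (b, c) = j ∨ pathPos g (b, c) = j + 1) → b = seat ⟨c, hc⟩ := by
    intro c hc b hb
    have := hseat ⟨c, hc⟩
    unfold pathPos at hb this
    dsimp only at hb this
    exact Fin.ext (by omega)
  induction k with
  | zero =>
    refine ⟨fun a => ?_, fun v h₁ h₂ => ?_⟩
    · refine ((joint π (π.attack q g inp j I) κ x).run_of_le_start
        (v := Sum.inl a) _ le_rfl).trans ?_
      have : seatedInput q g inp j κ x (seat a, a.1) = x a.1 := if_pos (hseat a)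
      exact congrArg (fun y => some ((π a.1).initial y)) this.symm
    · refine ((joint π (π.attack q g inp j I) κ x).run_of_le_start
        (v := Sum.inr (true, v)) _ le_rfl).trans ?_
      have : seatedInput q g inp j κ x v = inp κ v := if_neg (by tauto)
      exact congrArg (fun y => some ((π v.2).initial y)) this.symm
  | succ k ih =>
    refine ⟨fun a => ?_, fun v h₁ h₂ => ?_⟩
    · rw [pathRun_succ, ← ih.1 a]
      refine ((joint π (π.attack q g inp j I) κ x).run_succ_of_le
        (v := Sum.inl a) (Nat.le_add_right _ k) _).trans ?_
      have htape : (ω ∘ seatedTape q g j I κ) (seat a, a.1) = ω (Sum.inl a) :=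
        congrArg ω (dif_pos ⟨hseat a, a.2⟩)
      rw [htape]
      refine congrArg (fun msg => (π a.1).activate (ω (Sum.inl a)) msg
        (π.attackedRun q g inp j I κ x ω (q κ + 1 + k) a))
        (funext fun c : {j : Fin n // j ≠ a.1} => ?_)
      unfold pathIncoming
      rcases Nat.eq_zero_or_pos k with rfl | hk
      · exact (joint π (π.attack q g inp j I) κ x).incoming_of_le (v := Sum.inl a) le_rfl _ c
      rw [if_neg hk.ne']
      have hlt : (joint π (π.attack q g inp j I) κ x).start (Sum.inl a) < q κ + 1 + k :=
        Nat.lt_add_of_pos_right hk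
      have hpa := hseat a
      by_cases hc : c.1 ∈ I
      · have hsrc : (joint π (π.attack q g inp j I) κ x).src (Sum.inl a) c =
            (nearCopy (q κ) g (pathPos g (seat a, a.1)) c.1).map fun b =>
              ⟨Sum.inr (true, (b, c.1)), ⟨a.1, Ne.symm c.2⟩⟩ := by
          refine (dif_pos hc).trans ?_
          -- Of the positions near `j`, an honest party can occupy only `j` or `j + 1`, so this
          -- lookup finds its seat.
          have hb : nearCopy (q κ) g j a.1 = some (seat a) :=
            nearCopy_eq_some_iff.2 (by omega)
          simp only [attack, hb, Option.bind_some, Option.map_map]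
          rfl
        cases hb : nearCopy (q κ) g (pathPos g (seat a, a.1)) c.1 with
        | none =>
          exact (joint π (π.attack q g inp j I) κ x).incoming_of_none
            (hsrc.trans (congrArg (Option.map _) hb)) _ _
        | some b =>
          refine ((joint π (π.attack q g inp j I) κ x).incoming_of_some hlt
            (hsrc.trans (congrArg (Option.map _) hb)) _).trans ?_
          have hgc := (hI c.1).1 hc
          have hne : pathPos g (b, c.1) ≠ j ∧ pathPos g (b, c.1) ≠ j + 1 := by
            unfold pathPos
            dsimp only
            omega
          exact congrArg (fun s => ITM.sent s ⟨a.1, Ne.symm c.2⟩) (ih.2 (b, c.1) hne.1 hne.2)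
      · have hsrc : (joint π (π.attack q g inp j I) κ x).src (Sum.inl a) c =
            some ⟨Sum.inl ⟨c.1, hc⟩, ⟨a.1, Ne.symm c.2⟩⟩ := dif_neg hc
        have hpc := hseat ⟨c.1, hc⟩
        have hb : nearCopy (q κ) g (pathPos g (seat a, a.1)) c.1 = some (seat ⟨c.1, hc⟩) :=
          nearCopy_eq_some_iff.2 (by dsimp only at hpc; omega)
        rw [hb]
        refine ((joint π (π.attack q g inp j I) κ x).incoming_of_some hlt hsrc _).trans ?_
        exact congrArg (fun s => ITM.sent s ⟨a.1, Ne.symm c.2⟩) (ih.1 ⟨c.1, hc⟩)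
    · rw [pathRun_succ, ← ih.2 v h₁ h₂]
      refine ((joint π (π.attack q g inp j I) κ x).run_succ_of_le
        (v := Sum.inr (true, v)) (Nat.le_add_right _ k) _).trans ?_
      have htape : (ω ∘ seatedTape q g j I κ) v = ω (Sum.inr v) :=
        congrArg ω (dif_neg (by tauto))
      rw [htape]
      refine congrArg (fun msg => (π v.2).activate (ω (Sum.inr v)) msg
        (π.simulatedRun q g inp j I κ x ω (q κ + 1 + k) v))
        (funext fun c : {j : Fin n // j ≠ v.2} => ?_)
      unfold pathIncoming
      rcases Nat.eq_zero_or_pos k with rfl | hk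
      · exact (joint π (π.attack q g inp j I) κ x).incoming_of_le
          (v := Sum.inr (true, v)) le_rfl _ c
      rw [if_neg hk.ne']
      have hlt : (joint π (π.attack q g inp j I) κ x).start (Sum.inr (true, v)) < q κ + 1 + k :=
        Nat.lt_add_of_pos_right hk
      cases hb : nearCopy (q κ) g (pathPos g v) c.1 with
      | none =>
        have hsrc : (joint π (π.attack q g inp j I) κ x).src (Sum.inr (true, v)) c = none := by
          simp only [joint, jointSrc, attack, hb]
          rfl
        exact (joint π (π.attack q g inp j I) κ x).incoming_of_none hsrc _ _
      | some b =>
        have hnear := nearCopy_eq_some_iff.1 hb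
        by_cases hbj : pathPos g (b, c.1) = j ∨ pathPos g (b, c.1) = j + 1
        · have hc : c.1 ∉ I := by
            rw [hI]
            unfold pathPos at hbj
            dsimp only at hbj
            omega
          -- A position next to a seat but not itself a seat is `j - 1` or `j + 2`, which carries
          -- the corrupted residue.
          have hv : v.2 ∈ I := by
            rw [hI]
            unfold pathPos at hbj hnear h₁ h₂
            dsimp only at hbj hnear
            omega
          have hsrc : (joint π (π.attack q g inp j I) κ x).src (Sum.inr (true, v)) c =
              some ⟨Sum.inl ⟨c.1, hc⟩, ⟨v.2, Ne.symm c.2⟩⟩ := by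
            simp only [joint, jointSrc, attack, hb]
            simp [hbj, hc, hv, jointHonest]
          refine ((joint π (π.attack q g inp j I) κ x).incoming_of_some hlt hsrc _).trans ?_
          rw [hseat_eq c.1 hc b hbj]
          exact congrArg (fun s => ITM.sent s ⟨v.2, Ne.symm c.2⟩) (ih.1 ⟨c.1, hc⟩)
        · have hsrc : (joint π (π.attack q g inp j I) κ x).src (Sum.inr (true, v)) c =
              some ⟨Sum.inr (true, (b, c.1)), ⟨v.2, Ne.symm c.2⟩⟩ := by
            simp only [joint, jointSrc, attack, hb]
            simp [hbj, jointProc]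
          refine ((joint π (π.attack q g inp j I) κ x).incoming_of_some hlt hsrc _).trans ?_
          rw [not_or] at hbj
          exact congrArg (fun s => ITM.sent s ⟨v.2, Ne.symm c.2⟩) (ih.2 (b, c.1) hbj.1 hbj.2)

/-- The honest parties output `y` under the attack if and only if the copies of parties at the
positions `j` and `j + 1` output `y` in the simulated network. -/
theorem allOutput_attack_iff (hI : ∀ i, i ∈ I ↔ (g i).val ≠ j % 3 ∧ (g i).val ≠ (j + 1) % 3)
    (hj : j + 1 < 3 * q κ) (hR : π.IsRound q) (hinp : ∀ v, (inp κ v).length = κ)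
    (hx : ∀ i, (x i).length = κ) (ω : Coins (π.attack q g inp j I) κ) (y : List Bool) :
    π.AllOutput (π.attack q g inp j I) κ x ω y ↔
      ∀ v, (pathPos g v = j ∨ pathPos g v = j + 1) →
        π.pathOutput g (seatedInput q g inp j κ x) (q κ) (ω ∘ seatedTape q g j I κ) v =
          some y := by
  have hex : ∀ a : {a : Fin n // a ∉ I}, ∃ b : Fin (q κ),
      pathPos g (b, a.1) = j ∨ pathPos g (b, a.1) = j + 1 := by
    intro a
    have ha := a.2
    have hg := (g a.1).isLt
    rw [hI] at ha
    -- This is the last copy at a position at most `j + 1`; the residue of an honest party forces it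
    -- to `j` or `j + 1`.
    refine ⟨⟨(j + 1 - (g a.1).val) / 3, by omega⟩, ?_⟩
    unfold pathPos
    dsimp only
    omega
  choose seat hseat using hex
  have hlen : ∀ v, (seatedInput q g inp j κ x v).length = κ := by
    intro v
    unfold seatedInput
    split_ifs
    exacts [hx _, hinp _]
  have hout : ∀ a : {a : Fin n // a ∉ I},
      (joint π (π.attack q g inp j I) κ x).Outputs
        (fun v => ω (Sum.map id ((π.attack q g inp j I).tape κ) v)) (Sum.inl a) y ↔
      π.pathOutput g (seatedInput q g inp j κ x) (q κ) (ω ∘ seatedTape q g j I κ)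
        (seat a, a.1) = some y := by
    intro a
    obtain ⟨z, hz⟩ := π.exists_pathOutput g (seatedInput q g inp j κ x) hR
      (ω ∘ seatedTape q g j I κ) (seat a, a.1)
    rw [hlen] at hz
    have h := (π.jointRun_attack q g inp κ x hI seat hseat ω (q κ + 1)).1 a
    rw [hz, Option.some_inj]
    -- The rehearsal takes `q κ + 1` rounds, and the protocol needs `q κ + 1` activations.
    refine Network.outputs_iff _ (k := q κ + 1 + (q κ + 1)) ?_
    exact (congrArg ITM.output h).trans hz
  constructor
  · intro h v hv
    have hvI : v.2 ∉ I := by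
      rw [hI]
      unfold pathPos at hv
      omega
    have heq : v = (seat ⟨v.2, hvI⟩, v.2) := by
      have := hseat ⟨v.2, hvI⟩
      unfold pathPos at hv this
      dsimp only at this
      exact Prod.ext (Fin.ext (by dsimp only; omega)) rfl
    rw [heq]
    exact (hout ⟨v.2, hvI⟩).1 (h ⟨v.2, hvI⟩)
  · exact fun h a => (hout a).2 (h _ (hseat a))

end Protocol

/-! ### Agreement of neighbours and the union bound -/

theorem exists_pathPos_eq {n m : ℕ} {g : Fin n → Fin 3} (hg : Function.Surjective g) {p : ℕ}
    (hp : p < 3 * m) : ∃ v : Fin m × Fin n, pathPos g v = p := by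
  obtain ⟨i, hi⟩ := hg ⟨p % 3, Nat.mod_lt p (by norm_num)⟩
  refine ⟨(⟨p / 3, by omega⟩, i), ?_⟩
  simp only [pathPos, hi]
  omega

theorem one_sub_le_measureReal_iInter {Ω : Type*} [MeasurableSpace Ω] {μ : Measure Ω}
    [IsProbabilityMeasure μ] {E : ℕ → Set Ω} (m : ℕ) {ε : ℝ}
    (hE : ∀ j < m, MeasurableSet (E j)) (h : ∀ j < m, 1 - ε ≤ μ.real (E j)) :
    1 - m * ε ≤ μ.real {ω | ∀ j < m, ω ∈ E j} := by
  have hset : {ω | ∀ j < m, ω ∈ E j} = (⋃ j ∈ Finset.range m, (E j)ᶜ)ᶜ := by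
    ext ω
    simp
  have hcompl : ∀ j ∈ Finset.range m, MeasurableSet (E j)ᶜ :=
    fun j hj => (hE j (Finset.mem_range.1 hj)).compl
  rw [hset, probReal_compl_eq_one_sub (Finset.measurableSet_biUnion _ hcompl)]
  have hle : μ.real (⋃ j ∈ Finset.range m, (E j)ᶜ) ≤ ∑ j ∈ Finset.range m, μ.real (E j)ᶜ :=
    measureReal_biUnion_finset_le _ _
  have hsum : ∑ j ∈ Finset.range m, μ.real (E j)ᶜ ≤ m * ε := by
    refine (Finset.sum_le_card_nsmul _ _ ε fun j hj => ?_).trans (by simp)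
    rw [probReal_compl_eq_one_sub (hE j (Finset.mem_range.1 hj))]
    linarith [h j (Finset.mem_range.1 hj)]
  linarith

namespace Protocol

variable {n : ℕ} (π : Protocol n) {q : ℕ → ℕ} (g : Fin n → Fin 3)

/-- The copies at the positions `j` and `j + 1` agree on their output. -/
def PathAgree {m : ℕ} (inp : Fin m × Fin n → List Bool) (r j : ℕ)
    (ω : Fin m × Fin n → ℕ → Bool) : Prop :=
  ∃ y, ∀ v, (pathPos g v = j ∨ pathPos g v = j + 1) → π.pathOutput g inp r ω v = some y

/-- The seated tapes are distinct, hence jointly distributed as independent tapes of the path. -/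
theorem prob_attack {inp : ∀ κ, Fin (q κ) × Fin n → List Bool} {j : ℕ} {I : Finset (Fin n)}
    {κ : ℕ} {P : (Fin (q κ) × Fin n → ℕ → Bool) → Prop} (hP : MeasurableSet {ω | P ω}) :
    prob (π.attack q g inp j I) κ (fun ω => P (ω ∘ seatedTape q g j I κ)) =
      (fairCoins (Fin (q κ) × Fin n)).real {ω | P ω} := by
  unfold prob Measure.real
  exact congrArg _ ((measurePreserving_fairCoins_comp
    (injective_seatedTape q g j I κ)).measure_preimage hP.nullMeasurableSet)

theorem measurableSet_pathAgree {T : ℕ → ℕ} (hT : π.IsTime T) {m : ℕ}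
    (inp : Fin m × Fin n → List Bool) (r j : ℕ) :
    MeasurableSet {ω | π.PathAgree g inp r j ω} :=
  π.measurableSet_pathOutput g inp hT r fun out =>
    ∃ y, ∀ v, (pathPos g v = j ∨ pathPos g v = j + 1) → out v = some y

/-- By consistency, neighbouring copies agree with high probability. -/
theorem le_measure_pathAgree {t : ℕ} {T : ℕ → ℕ} {γ : ℕ → ℝ} (hT : π.IsTime T) (hR : π.IsRound q)
    (hcons : π.IsConsistent γ t (fun κ => 2 * n * q κ * T κ))
    (hcard : ∀ r : Fin 3, (Finset.univ.filter fun i => g i = r).card ≤ t)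
    (inp : ∀ κ, Fin (q κ) × Fin n → List Bool) (hinp : ∀ κ v, (inp κ v).length = κ)
    (κ j : ℕ) (hj : j + 1 < 3 * q κ) :
    γ κ ≤ (fairCoins (Fin (q κ) × Fin n)).real {ω | π.PathAgree g (inp κ) (q κ) j ω} := by
  classical
  set I : Finset (Fin n) :=
    Finset.univ.filter fun i => g i = ⟨(j + 2) % 3, Nat.mod_lt _ (by norm_num)⟩
  have hI : ∀ i, i ∈ I ↔ (g i).val ≠ j % 3 ∧ (g i).val ≠ (j + 1) % 3 := by
    intro i
    have := (g i).isLt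
    simp only [I, Finset.mem_filter, Finset.mem_univ, true_and, Fin.ext_iff]
    omega
  -- Each honest party gets the input of its copy, so that seating it leaves the inputs of the path
  -- unchanged. The default is for parties without a copy at the seats.
  set x : Fin n → List Bool := fun i =>
    if h : ∃ b : Fin (q κ), pathPos g (b, i) = j ∨ pathPos g (b, i) = j + 1 then
      inp κ (h.choose, i) else List.replicate κ false
  have hx : ∀ i, (x i).length = κ := by
    intro i
    simp only [x]
    split_ifs
    · exact hinp _ _
    · simp
  have hseated : seatedInput q g inp j κ x = inp κ := by
    funext v
    unfold seatedInput
    split_ifs with hv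
    · have h : ∃ b : Fin (q κ), pathPos g (b, v.2) = j ∨ pathPos g (b, v.2) = j + 1 := ⟨v.1, hv⟩
      have huniq : ∀ b : Fin (q κ), (pathPos g (b, v.2) = j ∨ pathPos g (b, v.2) = j + 1) →
          (b, v.2) = v := by
        intro b hb
        unfold pathPos at hv hb
        refine Prod.ext (Fin.ext ?_) rfl
        dsimp only at hb ⊢
        omega
      simp only [x]
      rw [dif_pos h, huniq _ h.choose_spec]
    · rfl
  have hmain := hcons I (hcard _) (π.attack q g inp j I) (π.isTime_attack q g inp j I hT hinp)
    κ x hx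
  rw [← π.prob_attack g (inp := inp) (j := j) (I := I)
    (π.measurableSet_pathAgree g hT (inp κ) (q κ) j)]
  convert hmain using 4 with ω
  rw [PathAgree]
  refine exists_congr fun y => ?_
  rw [π.allOutput_attack_iff q g inp κ x hI hj hR (hinp κ) hx, hseated]

/-- If all pairs of neighbours agree up to the position `p`, then all copies up to there have
the same output. -/
theorem exists_pathOutput_eq (hg : Function.Surjective g) {m : ℕ}
    {inp : Fin m × Fin n → List Bool} {r p : ℕ} (hp : p < 3 * m) (hp0 : 0 < p)
    {ω : Fin m × Fin n → ℕ → Bool} (h : ∀ j < p, π.PathAgree g inp r j ω) :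
    ∃ y, ∀ v, pathPos g v ≤ p → π.pathOutput g inp r ω v = some y := by
  obtain ⟨y, hy⟩ := h 0 hp0
  refine ⟨y, ?_⟩
  suffices ∀ k ≤ p, ∀ v, pathPos g v = k → π.pathOutput g inp r ω v = some y from
    fun v hv => this _ hv v rfl
  intro k
  induction k with
  | zero => exact fun _ v hv => hy v (Or.inl hv)
  | succ k ih =>
    intro hk v hv
    obtain ⟨z, hz⟩ := h k hk
    -- An empty position would break the chain: a copy at `k` is needed to identify `z` with `y`.
    obtain ⟨w, hw⟩ := exists_pathPos_eq hg (m := m) (p := k) (by omega)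
    rw [hz v (Or.inr hv), ← hz w (Or.inl hw), ih (by omega) w hw]

/-- The announced value is the output of all honest parties, unless some of the first neighbours
on the path disagree. -/
theorem le_prob_attack {t : ℕ} {T : ℕ → ℕ} {δ : ℕ → ℝ} (hT : π.IsTime T) (hR : π.IsRound q)
    (hq : ∀ κ, 2 ≤ q κ)
    (hcons : π.IsConsistent (fun κ => 1 - δ κ) t (fun κ => 2 * n * q κ * T κ))
    (hg : Function.Surjective g)
    (hcard : ∀ r : Fin 3, (Finset.univ.filter fun i => g i = r).card ≤ t)
    (I : Finset (Fin n)) (hI : ∀ i, i ∈ I ↔ g i = 2) (κ : ℕ) (x : Fin n → List Bool)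
    (hx : ∀ i, (x i).length = κ) :
    1 - ((q κ : ℝ) + 2) * δ κ ≤
      prob (π.attack q g (fun κ _ => List.replicate κ false) 0 I) κ fun ω =>
        ∃ y, (π.attack q g (fun κ _ => List.replicate κ false) 0 I).announced κ
            (fun j => ω (Sum.inr j)) = some y ∧
          π.AllOutput (π.attack q g (fun κ _ => List.replicate κ false) 0 I) κ x ω y := by
  set zero : ∀ κ, Fin (q κ) × Fin n → List Bool := fun κ _ => List.replicate κ false
  have hq2 := hq κ
  have hI' : ∀ i, i ∈ I ↔ (g i).val ≠ 0 % 3 ∧ (g i).val ≠ (0 + 1) % 3 := by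
    intro i
    have := (g i).isLt
    rw [hI, Fin.ext_iff, show ((2 : Fin 3) : ℕ) = 2 from rfl]
    omega
  -- The inputs `x` are placed at the positions `0` and `1`. The length test keeps the family valid
  -- at other security parameters, as the time bound of the adversary requires.
  set inp : ∀ κ, Fin (q κ) × Fin n → List Bool := fun κ' v =>
    if (pathPos g v = 0 ∨ pathPos g v = 0 + 1) ∧ (x v.2).length = κ' then x v.2
    else List.replicate κ' false
  have hinp : ∀ κ' v, (inp κ' v).length = κ' := by
    intro κ' v
    simp only [inp]
    split_ifs with h
    · exact h.2
    · simp
  have hseated : seatedInput q g zero 0 κ x = inp κ := by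
    funext v
    simp [seatedInput, inp, zero, hx]
  have hmeas := fun j => π.measurableSet_pathAgree g hT (inp κ) (q κ) j
  have hpath := one_sub_le_measureReal_iInter (μ := fairCoins (Fin (q κ) × Fin n))
    (E := fun j => {ω | π.PathAgree g (inp κ) (q κ) j ω}) (q κ + 2) (fun j _ => hmeas j)
    fun j hj => π.le_measure_pathAgree g hT hR hcons hcard inp hinp κ j (by omega)
  have hmeas_all : MeasurableSet
      {ω | ∀ j < q κ + 2, ω ∈ {ω | π.PathAgree g (inp κ) (q κ) j ω}} := by
    simp only [Set.ofPred_forall]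
    exact MeasurableSet.iInter fun j => MeasurableSet.iInter fun _ => hmeas j
  rw [← π.prob_attack g (inp := zero) (j := 0) (I := I) hmeas_all] at hpath
  push_cast at hpath
  refine hpath.trans (measureReal_mono fun ω hω => ?_)
  obtain ⟨v, hv, hann⟩ := π.exists_announced_attack q g zero 0 I (κ := κ)
    (exists_pathPos_eq hg (by omega))
  obtain ⟨y, hy⟩ := π.exists_pathOutput_eq g hg (p := q κ + 2) (by omega) (by omega) hω
  refine ⟨y, ?_, ?_⟩
  · rw [← hy v hv.le]
    -- Rehearsal and execution differ only in inputs and tapes at the positions `0` and `1`, whose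
    -- influence cannot reach `q κ + 2` within `q κ + 1` activations.
    refine (hann _).trans (congrArg ITM.output (π.pathRun_congr g (zero κ) ?_ ?_ _ v ?_ ?_))
    · intro w hw
      simp only [inp, zero]
      rw [if_neg (by omega)]
    · intro w hw
      have hw0 : ¬((pathPos g w = 0 ∨ pathPos g w = 0 + 1) ∧ w.2 ∉ I) := by omega
      exact (congrArg ω (show seatedTape q g 0 I κ w = Sum.inr w from dif_neg hw0)).symm
    · omega
    · omega
  · rw [π.allOutput_attack_iff q g zero κ x hI' (by omega) hR (by simp [zero]) hx, hseated]
    exact fun w hw => hy w (by omega)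

end Protocol

/-! ### Choice of the groups and conclusion -/

/-- The parties outside a set of size `s` can be split into two groups that the adversary
may corrupt. -/
theorem exists_grouping {n t s : ℕ} (hn : 3 ≤ n) (ht : n ≤ 3 * t)
    (hs : s = if 2 * t < n then n - 2 * t else 1) (I : Finset (Fin n)) (hI : I.card = s) :
    ∃ g : Fin n → Fin 3, Function.Surjective g ∧
      (∀ r : Fin 3, (Finset.univ.filter fun i => g i = r).card ≤ t) ∧ ∀ i, i ∈ I ↔ g i = 2 := by
  have hcompl : Iᶜ.card = n - s := by rw [Finset.card_compl, Fintype.card_fin, hI]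
  -- Halving works: if `2 * t < n` then `n - s = 2 * t` and `s ≤ t`; otherwise the larger half of `n
  -- - 1` is at most `n / 2 ≤ t`.
  obtain ⟨B, hBI, hB⟩ := Finset.exists_subset_card_eq (s := Iᶜ) (n := (n - s) / 2) (by omega)
  have hdisj : ∀ i ∈ B, i ∉ I := fun i hi => Finset.mem_compl.1 (hBI hi)
  have hC : (Iᶜ \ B).card = n - s - (n - s) / 2 := by
    rw [Finset.card_sdiff_of_subset hBI, hcompl, hB]
  set g : Fin n → Fin 3 := fun i => if i ∈ I then 2 else if i ∈ B then 1 else 0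
  have hg2 : (Finset.univ.filter fun i => g i = 2) = I := by
    ext i
    by_cases h₁ : i ∈ I <;> by_cases h₂ : i ∈ B <;> simp [g, h₁, h₂]
  have hg1 : (Finset.univ.filter fun i => g i = 1) = B := by
    ext i
    by_cases h₁ : i ∈ I
    · simpa [g, h₁] using fun h => hdisj i h h₁
    · by_cases h₂ : i ∈ B <;> simp [g, h₁, h₂]
  have hg0 : (Finset.univ.filter fun i => g i = 0) = Iᶜ \ B := by
    ext i
    by_cases h₁ : i ∈ I <;> by_cases h₂ : i ∈ B <;> simp [g, h₁, h₂]
  have hbound : ∀ r : Fin 3, 0 < (Finset.univ.filter fun i => g i = r).card ∧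
      (Finset.univ.filter fun i => g i = r).card ≤ t := by
    intro r
    fin_cases r
    · change 0 < (Finset.univ.filter fun i => g i = 0).card ∧
        (Finset.univ.filter fun i => g i = 0).card ≤ t
      rw [hg0, hC]
      split_ifs at hs <;> omega
    · change 0 < (Finset.univ.filter fun i => g i = 1).card ∧
        (Finset.univ.filter fun i => g i = 1).card ≤ t
      rw [hg1, hB]
      split_ifs at hs <;> omega
    · change 0 < (Finset.univ.filter fun i => g i = 2).card ∧
        (Finset.univ.filter fun i => g i = 2).card ≤ t
      rw [hg2, hI]
      split_ifs at hs <;> omega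
  refine ⟨g, fun r => ?_, fun r => (hbound r).2, fun i => ?_⟩
  · obtain ⟨i, hi⟩ := Finset.card_pos.1 (hbound r).1
    exact ⟨i, (Finset.mem_filter.1 hi).2⟩
  · rw [← hg2]
    simp

theorem mainTheorem3 (n t s : ℕ) (hn : 3 ≤ n) (ht : n ≤ 3 * t)
    (hs : s = if 2 * t < n then n - 2 * t else 1)
    (T q : ℕ → ℕ) (hq : ∀ κ, 2 ≤ q κ) (δ : ℕ → ℝ)
    (π : Protocol n) (hT : π.IsTime T) (hR : π.IsRound q)
    (hcons : π.IsConsistent (fun κ => 1 - δ κ) t (fun κ => 2 * n * q κ * T κ)) :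
    ∃ D : ∀ I : Finset (Fin n), Adversary n I,
      (∀ I, (D I).IsTime (fun κ => 2 * n * q κ * T κ)) ∧
      ∀ I : Finset (Fin n), I.card = s → ∀ κ : ℕ,
        (∀ ω, ∃ y, (D I).announced κ ω = some y) ∧
        ∀ x : Fin n → List Bool, (∀ i, (x i).length = κ) →
          1 - (3 / 2 * (q κ : ℝ) + 1) * δ κ ≤
            Protocol.prob (D I) κ fun ω =>
              ∃ y, (D I).announced κ (fun j => ω (Sum.inr j)) = some y ∧
                π.AllOutput (D I) κ x ω y := by
  have hgroup : ∀ I : Finset (Fin n), ∃ g : Fin n → Fin 3, I.card = s →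
      Function.Surjective g ∧
        (∀ r : Fin 3, (Finset.univ.filter fun i => g i = r).card ≤ t) ∧
        ∀ i, i ∈ I ↔ g i = 2 := by
    intro I
    by_cases hI : I.card = s
    · obtain ⟨g, hg⟩ := exists_grouping hn ht hs I hI
      exact ⟨g, fun _ => hg⟩
    -- For sets of another size any grouping will do, since only the time bound is claimed there.
    · exact ⟨fun _ => 0, fun h => absurd h hI⟩
  choose g hg using hgroup
  refine ⟨fun I => π.attack q (g I) (fun κ _ => List.replicate κ false) 0 I,
    fun I => π.isTime_attack q (g I) _ 0 I hT (by simp), fun I hI κ => ⟨fun ω => ?_, ?_⟩⟩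
  · obtain ⟨v, -, hann⟩ := π.exists_announced_attack q (g I)
      (fun κ _ => List.replicate κ false) 0 I (κ := κ)
      (exists_pathPos_eq (hg I hI).1 (by have := hq κ; omega))
    obtain ⟨y, hy⟩ := π.exists_pathOutput (g I) (fun _ => List.replicate κ false) hR ω v
    rw [List.length_replicate] at hy
    exact ⟨y, (hann ω).trans hy⟩
  · intro x hx
    obtain ⟨hsurj, hcard, hmem⟩ := hg I hI
    refine le_trans ?_ (π.le_prob_attack (g I) hT hR hq hcons hsurj hcard I hmem κ x hx)
    -- Nonnegativity is forced by consistency, as a probability is at most `1`; it is needed to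
    -- enlarge the factor `q κ + 2`.
    have hδ : 0 ≤ δ κ := by
      have h := π.le_measure_pathAgree (g I) hT hR hcons hcard
        (fun κ _ => List.replicate κ false) (by simp) κ 0 (by have := hq κ; omega)
      linarith [h.trans measureReal_le_one]
    have hq' : (2 : ℝ) ≤ q κ := by exact_mod_cast hq κ
    nlinarith
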